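/- Let $a<0$, $b>0$, $\gamma>0$, $\theta\in\mathbb R$ and $\bar r\neq 0$ be constants. For $t_0\ge 0$ consider, on $[t_0,\infty)$, the scalar adaptive system with open-loop reference model $$\dot x = a x - b\theta x + b u,\qquad u=\hat\theta x+\bar r,\qquad \dot x_m = a x_m + b\bar r,\qquad \dot{\hat\theta} = -\gamma x e,\qquad e = x-x_m,$$ and put $\phi=\hat\theta-\theta$ and $z=[e,\phi]^{\mathsf T}\in\mathbb R^2$, with the Euclidean norm. For all $t_0\ge 0$ and all initial values $x(t_0),x_m(t_0),\hat\theta(t_0)\in\mathbb R$ the system has exactly one solution on $[t_0,\infty)$, and the equilibrium $z=0$ of the error dynamics is uniformly asymptotically stable in the large (UASL). That is: 1. (uniformly stable) for every $\varepsilon>0$ there is $\delta(\varepsilon)>0$ such that $\|z(t_0)\|\le\delta$ implies $\|z(t)\|\le\varepsilon$ for all $t\ge t_0$; 2. (uniformly bounded) for every $\rho>0$ there is $B(\rho)$ such that $\|z(t_0)\|\le\rho$ implies $\|z(t)\|\le B$ for all $t\ge t_0$; 3. (uniformly attracting in the large) for all $\rho>0$ and $\eta>0$ there is $T(\eta,\rho)\ge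 0$ such that $\|z(t_0)\|\le\rho$ implies $\|z(t)\|\le\eta$ for all $t\ge t_0+T$. Here $\delta$, $B$, $T$ may depend on $a,b,\gamma,\theta,\bar r$, but not on the initial time $t_0\ge 0$ nor on the initial values of the solution (in particular not on $x_m(t_0)$). -/

import Mathlib

/-- `[e, φ]ᵀ` as a vector of the Euclidean plane. -/
abbrev Plane : Type := EuclideanSpace ℝ (Fin 2)

/-- The closed-loop scalar adaptive system with open-loop reference model and constant
reference `r`: the functions `x` (plant state), `xm` (reference state) and `θh` (parameter
estimate) solve, on `[t₀, ∞)`,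
`x' = a x - b θ x + b u` with `u = θh x + r`, `xm' = a xm + b r`, `θh' = -γ x e` with `e = x - xm`.
At `t₀` the derivative is the right derivative. -/
structure IsORMSolution (a b θ γ r t₀ : ℝ) (x xm θh : ℝ → ℝ) : Prop where
  plant : ∀ t, t₀ ≤ t →
    HasDerivWithinAt x (a * x t - b * θ * x t + b * (θh t * x t + r)) (Set.Ici t₀) t
  reference : ∀ t, t₀ ≤ t →
    HasDerivWithinAt xm (a * xm t + b * r) (Set.Ici t₀) t
  update : ∀ t, t₀ ≤ t →
    HasDerivWithinAt θh (-γ * x t * (x t - xm t)) (Set.Ici t₀) t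

/-- The error trajectories `z = [e, φ]ᵀ`, `e = x - xm`, `φ = θh - θ`, of the system started at
time `t₀`, over all initial values of `x`, `xm`, `θh`. -/
def ormErrorTrajectories (a b θ γ r t₀ : ℝ) : Set (ℝ → Plane) :=
  {z | ∃ x xm θh : ℝ → ℝ, IsORMSolution a b θ γ r t₀ x xm θh ∧
    ∀ t, t₀ ≤ t → z t = !₂[x t - xm t, θh t - θ]}

section Stability

/-! Stability of the origin for a system given by its trajectories: `S t₀` is the set of
trajectories (on `[t₀, ∞)`) that start at the time `t₀`. -/

variable {E : Type*} [NormedAddCommGroup E]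

/-- Uniform stability of the origin: `δ` depends on `ε` only. -/
def UniformlyStable (S : ℝ → Set (ℝ → E)) : Prop :=
  ∀ ε : ℝ, 0 < ε → ∃ δ : ℝ, 0 < δ ∧ ∀ t₀ : ℝ, 0 ≤ t₀ → ∀ z ∈ S t₀, ‖z t₀‖ ≤ δ → ∀ t ≥ t₀, ‖z t‖ ≤ ε

/-- Uniform boundedness: the bound `B` depends on `ρ` only. -/
def UniformlyBounded (S : ℝ → Set (ℝ → E)) : Prop :=
  ∀ ρ : ℝ, 0 < ρ → ∃ B : ℝ, ∀ t₀ : ℝ, 0 ≤ t₀ → ∀ z ∈ S t₀, ‖z t₀‖ ≤ ρ → ∀ t ≥ t₀, ‖z t‖ ≤ B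

/-- Uniform attraction in the large: the attraction time `T ≥ 0` depends on `ρ` and `η` only. -/
def UniformlyAttractingInTheLarge (S : ℝ → Set (ℝ → E)) : Prop :=
  ∀ ρ : ℝ, 0 < ρ → ∀ η : ℝ, 0 < η → ∃ T : ℝ, 0 ≤ T ∧ ∀ t₀ : ℝ, 0 ≤ t₀ → ∀ z ∈ S t₀,
    ‖z t₀‖ ≤ ρ → ∀ t ≥ t₀ + T, ‖z t‖ ≤ η

/-- Uniform asymptotic stability in the large of the origin. -/
structure IsUASL (S : ℝ → Set (ℝ → E)) : Prop where
  stable : UniformlyStable S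
  bounded : UniformlyBounded S
  attracting : UniformlyAttractingInTheLarge S

end Stability

/-!
In the coordinates `e = x - xm`, `ψ = b (θh - θ)`, with `g = b γ` and `s = b r`, the system reads
`e' = a e + x ψ`, `ψ' = -g x e`, `x' = (a + ψ) x + s`. The energy `U = g e² + ψ²` satisfies
`U' = 2 a g e²`, which gives stability but controls only `e`. Convergence of `ψ` comes from the
excitation by `s ≠ 0`: correct the energy by a multiple of `M = ψ (e + μ s ψ) x / (1 + x²)`. The
first part of `M` contributes `ψ² x² / (1 + x²)` to `M'`, hence controls `ψ` away from `x = 0`;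
since `x' = s` at `x = 0`, the second contributes about `μ s² ψ²` near `x = 0`. So `U - l M` is a
strict Lyapunov function for small `l`. It uses `x / (1 + x²)` instead of `x` because `x` has no
bound that is uniform in `xm(t₀)`; the constants then depend on the solution only through a bound
for `ψ`, that is, through the initial energy.

Adding the square of the velocity `a xm + s` of the reference state to `U` makes its sublevel sets
bounded, so solutions exist for all later times.
-/

open Set Metric Filter Topology
open scoped Manifold

section ODE

variable {E : Type*} [NormedAddCommGroup E] [NormedSpace ℝ E] {v : E → E} {t₀ : ℝ}

theorem hasDerivWithinAt_prodMk_iff {F : Type*} [NormedAddCommGroup F] [NormedSpace ℝ F]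
    {f : ℝ → E} {g : ℝ → F} {f' : E} {g' : F} {s : Set ℝ} {t : ℝ} :
    HasDerivWithinAt (fun τ => (f τ, g τ)) (f', g') s t ↔
      HasDerivWithinAt f f' s t ∧ HasDerivWithinAt g g' s t :=
  ⟨fun h => ⟨by simpa using h.hasFDerivWithinAt.fst.hasDerivWithinAt,
    by simpa using h.hasFDerivWithinAt.snd.hasDerivWithinAt⟩, fun h => h.1.prodMk h.2⟩

theorem exists_isIntegralCurve_of_contDiff_of_hasCompactSupport [CompleteSpace E]
    (hv : ContDiff ℝ 1 v) (hv_supp : HasCompactSupport v) (p : E) (t₀ : ℝ) :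
    ∃ α : ℝ → E, α t₀ = p ∧ IsIntegralCurve α fun _ => v := by
  obtain ⟨K, hK⟩ := hv.lipschitzWith_of_hasCompactSupport hv_supp one_ne_zero
  obtain ⟨C, hC⟩ := hv_supp.exists_bound_of_continuous hv.continuous
  lift C to NNReal using (norm_nonneg _).trans (hC p)
  have curve_on_Ioo (d : ℝ) : ∃ α : ℝ → E, α 0 = p ∧
      IsMIntegralCurveOn (I := 𝓘(ℝ, E)) α v (Ioo (-d) d) := by
    have hd : (0 : ℝ) ∈ Icc (-|d|) |d| := by simp
    have hpl : IsPicardLindelof (fun _ => v) (⟨0, hd⟩ : Icc (-|d|) |d|) p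
        (C * ‖d‖₊) 0 C K :=
      .of_time_independent (fun q _ => hC q) hK.lipschitzOnWith (by simp)
    obtain ⟨α, hα₀, hα⟩ := hpl.exists_eq_forall_mem_Icc_hasDerivWithinAt₀
    have hsub : Ioo (-d) d ⊆ Icc (-|d|) |d| :=
      Ioo_subset_Icc_self.trans (Icc_subset_Icc (neg_le_neg (le_abs_self d)) (le_abs_self d))
    exact ⟨α, hα₀, fun t ht =>
      ((hα t (hsub ht)).mono hsub).hasFDerivWithinAt.hasMFDerivWithinAt⟩
  obtain ⟨α, hα₀, hα⟩ := (exists_isMIntegralCurve_iff_exists_isMIntegralCurveOn_Ioo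
    (contMDiff_vectorSpace_iff_contDiff.2 hv) p).2 curve_on_Ioo
  have hα' : IsIntegralCurve α fun _ => v := fun t => by
    have hαt : HasFDerivAt α ((1 : ℝ →L[ℝ] ℝ).smulRight (v (α t))) t :=
      hasMFDerivAt_iff_hasFDerivAt.1 (hα t)
    simpa using hαt.hasDerivAt
  exact ⟨fun t => α (t - t₀), by simpa using hα₀, hα'.comp_sub t₀⟩

theorem eqOn_Ici_of_isIntegralCurveOn (hv : LocallyLipschitz v) {α β : ℝ → E}
    (hα : IsIntegralCurveOn α (fun _ => v) (Ici t₀))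
    (hβ : IsIntegralCurveOn β (fun _ => v) (Ici t₀)) (h₀ : α t₀ = β t₀) :
    EqOn α β (Ici t₀) := by
  intro T hT
  have hαc : ContinuousOn α (Icc t₀ T) := hα.continuousOn.mono Icc_subset_Ici_self
  have hβc : ContinuousOn β (Icc t₀ T) := hβ.continuousOn.mono Icc_subset_Ici_self
  obtain ⟨K, hK⟩ := hv.locallyLipschitzOn.exists_lipschitzOnWith_of_compact
    ((isCompact_Icc.image_of_continuousOn hαc).union (isCompact_Icc.image_of_continuousOn hβc))
  exact ODE_solution_unique_of_mem_Icc_right (v := fun _ => v) (fun _ _ => hK)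
    hαc (fun t ht => (hα t ht.1).mono (Ici_subset_Ici.2 ht.1))
    (fun t ht => .inl (mem_image_of_mem _ (Ico_subset_Icc_self ht)))
    hβc (fun t ht => (hβ t ht.1).mono (Ici_subset_Ici.2 ht.1))
    (fun t ht => .inr (mem_image_of_mem _ (Ico_subset_Icc_self ht))) h₀ (right_mem_Icc.2 hT)

theorem antitoneOn_Ici_of_hasDerivWithinAt_nonpos {f f' : ℝ → ℝ}
    (hf : ∀ t ∈ Ici t₀, HasDerivWithinAt f (f' t) (Ici t₀) t) (hf' : ∀ t ∈ Ici t₀, f' t ≤ 0) :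
    AntitoneOn f (Ici t₀) :=
  antitoneOn_of_hasDerivWithinAt_nonpos (convex_Ici t₀) (HasDerivWithinAt.continuousOn hf)
    (fun t ht => (hf t (interior_subset ht)).mono interior_subset)
    fun t ht => hf' t (interior_subset ht)

theorem le_mul_exp_of_hasDerivWithinAt_Ici {f f' : ℝ → ℝ} {K : ℝ}
    (hf : ∀ t ∈ Ici t₀, HasDerivWithinAt f (f' t) (Ici t₀) t)
    (hf' : ∀ t ∈ Ici t₀, f' t ≤ K * f t) {t : ℝ} (ht : t₀ ≤ t) :
    f t ≤ f t₀ * Real.exp (K * (t - t₀)) := by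
  rw [← gronwallBound_ε0]
  refine le_gronwallBound_of_liminf_deriv_right_le (f' := f') (b := t)
    (fun s hs => (hf s hs.1).continuousWithinAt.mono Icc_subset_Ici_self) (fun s hs r hr => ?_)
    le_rfl (fun s hs => by simpa using hf' s hs.1) t ⟨ht, le_rfl⟩
  exact ((hf s hs.1).mono (Ici_subset_Ici.2 hs.1)).liminf_right_slope_le hr

theorem exists_isIntegralCurveOn_Ici_of_fderiv_nonpos [FiniteDimensional ℝ E]
    (hv : ContDiff ℝ 1 v) {W : E → ℝ} (hW : Differentiable ℝ W)
    (hW_nonpos : ∀ q, fderiv ℝ W q (v q) ≤ 0) (p : E)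
    (hW_bdd : Bornology.IsBounded {q | W q ≤ W p}) (t₀ : ℝ) :
    ∃ α : ℝ → E, α t₀ = p ∧ IsIntegralCurveOn α (fun _ => v) (Ici t₀) := by
  have := FiniteDimensional.complete ℝ E
  obtain ⟨R, hR, hsub⟩ := hW_bdd.subset_closedBall_lt 0 0
  let χ : ContDiffBump (0 : E) := ⟨R, R + 1, hR, lt_add_one R⟩
  obtain ⟨α, hα₀, hα⟩ := exists_isIntegralCurve_of_contDiff_of_hasCompactSupport
    (χ.contDiff.smul hv) (χ.hasCompactSupport.smul_right (f' := v)) p t₀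
  have hWα (t : ℝ) : HasDerivAt (W ∘ α) (χ (α t) * fderiv ℝ W (α t) (v (α t))) t := by
    simpa using (hW (α t)).hasFDerivAt.comp_hasDerivAt t (hα t)
  have W_le : ∀ t ∈ Ici t₀, W (α t) ≤ W p := fun t ht => hα₀ ▸
    antitoneOn_Ici_of_hasDerivWithinAt_nonpos (fun s _ => (hWα s).hasDerivWithinAt)
      (fun s _ => mul_nonpos_of_nonneg_of_nonpos χ.nonneg (hW_nonpos _)) self_mem_Ici ht ht
  refine ⟨α, hα₀, fun t ht => ?_⟩
  have χ_eq_one : χ (α t) = 1 := χ.one_of_mem_closedBall (hsub (W_le t ht))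
  simpa [χ_eq_one] using (hα t).hasDerivWithinAt

end ODE

section Dissipation

theorem le_mul_exp_of_corrected_dissipation {U U' M M' D : ℝ → ℝ} {t₀ A α β κ l : ℝ}
    (hU : ∀ t ∈ Ici t₀, HasDerivWithinAt U (U' t) (Ici t₀) t)
    (hM : ∀ t ∈ Ici t₀, HasDerivWithinAt M (M' t) (Ici t₀) t)
    (hU_nonneg : ∀ t ∈ Ici t₀, 0 ≤ U t) (hD : ∀ t ∈ Ici t₀, 0 ≤ D t)
    (hMU : ∀ t ∈ Ici t₀, |M t| ≤ A * U t) (hU' : ∀ t ∈ Ici t₀, U' t ≤ -α * D t)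
    (hM' : ∀ t ∈ Ici t₀, β * U t - κ * D t ≤ M' t)
    (hβ : 0 ≤ β) (hl : 0 ≤ l) (hlA : l * A ≤ 1 / 2) (hlκ : l * κ ≤ α) {t : ℝ} (ht : t₀ ≤ t) :
    U t ≤ 3 * U t₀ * Real.exp (-(l * β / 2) * (t - t₀)) := by
  have correction_le : ∀ s ∈ Ici t₀, |l * M s| ≤ U s / 2 := fun s hs => by
    rw [abs_mul, abs_of_nonneg hl]
    linarith [mul_le_mul_of_nonneg_left (hMU s hs) hl,
      mul_le_mul_of_nonneg_right hlA (hU_nonneg s hs)]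
  have corrected_deriv_le : ∀ s ∈ Ici t₀,
      U' s - l * M' s ≤ -(l * β / 2) * (U s - l * M s) := fun s hs => by
    have deriv_le : U' s - l * M' s ≤ -(l * β) * U s := by
      linarith [hU' s hs, mul_le_mul_of_nonneg_left (hM' s hs) hl,
        mul_le_mul_of_nonneg_right hlκ (hD s hs)]
    have le_two_mul : U s - l * M s ≤ 2 * U s := by
      linarith [neg_abs_le (l * M s), correction_le s hs, hU_nonneg s hs]
    linarith [mul_le_mul_of_nonneg_left le_two_mul (mul_nonneg hl hβ)]
  have decay := le_mul_exp_of_hasDerivWithinAt_Ici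
    (fun s hs => (hU s hs).sub ((hM s hs).const_mul l)) corrected_deriv_le ht
  have initial_le : U t₀ - l * M t₀ ≤ 3 / 2 * U t₀ := by
    linarith [neg_abs_le (l * M t₀), correction_le t₀ self_mem_Ici]
  calc U t ≤ 2 * (U t - l * M t) := by linarith [le_abs_self (l * M t), correction_le t ht]
    _ ≤ 2 * ((U t₀ - l * M t₀) * Real.exp (-(l * β / 2) * (t - t₀))) := by gcongr; exact decay
    _ ≤ 2 * (3 / 2 * U t₀ * Real.exp (-(l * β / 2) * (t - t₀))) := by gcongr
    _ = 3 * U t₀ * Real.exp (-(l * β / 2) * (t - t₀)) := by ring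

end Dissipation

section Saturation

/-- The saturation `x / (1 + x²)`, a bounded substitute for `x` in the correction of the energy:
the state `x` is not bounded in terms of the error alone. -/
noncomputable def saturation (x : ℝ) : ℝ := x / (1 + x ^ 2)

/-- The derivative of `saturation`. -/
noncomputable def saturationSlope (x : ℝ) : ℝ := (1 - x ^ 2) / (1 + x ^ 2) ^ 2

theorem hasDerivAt_saturation (x : ℝ) : HasDerivAt saturation (saturationSlope x) x := by
  have hx : (1 + x ^ 2 : ℝ) ≠ 0 := by positivity
  refine ((hasDerivAt_id x).div ((hasDerivAt_pow 2 x).const_add 1) hx).congr_deriv ?_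
  simp only [saturationSlope, id]
  ring

theorem abs_saturation_le_half (x : ℝ) : |saturation x| ≤ 1 / 2 := by
  rw [saturation, abs_div, abs_of_pos (by positivity : (0 : ℝ) < 1 + x ^ 2),
    div_le_iff₀ (by positivity)]
  linarith [sq_nonneg (|x| - 1), sub_sq |x| 1, sq_abs x]

theorem mul_saturation_nonneg (x : ℝ) : 0 ≤ x * saturation x := by
  rw [saturation, ← mul_div_assoc, ← sq]
  positivity

theorem mul_saturation_le_one (x : ℝ) : x * saturation x ≤ 1 := by
  rw [saturation, ← mul_div_assoc, div_le_one (by positivity)]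
  linarith [sq x]

theorem abs_saturationSlope_mul_le (p s x : ℝ) :
    |saturationSlope x * (p * x + s)| ≤ |p| + |s| := by
  have slope_le : |saturationSlope x| ≤ 1 / (1 + x ^ 2) := by
    rw [saturationSlope, abs_div, abs_of_pos (by positivity : (0 : ℝ) < (1 + x ^ 2) ^ 2),
      div_le_div_iff₀ (by positivity) (by positivity), one_mul, sq (1 + x ^ 2)]
    gcongr
    exact abs_le.2 ⟨by linarith [sq_nonneg x], by linarith [sq_nonneg x]⟩
  have velocity_le : |p * x + s| ≤ (|p| + |s|) * (1 + x ^ 2) := by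
    have abs_le_one_add_sq : |x| ≤ 1 + x ^ 2 := by
      linarith [sq_nonneg (|x| - 1), sub_sq |x| 1, sq_abs x, sq_nonneg x]
    calc |p * x + s| ≤ |p| * |x| + |s| * 1 := by
          simpa [abs_mul] using abs_add_le (p * x) s
      _ ≤ |p| * (1 + x ^ 2) + |s| * (1 + x ^ 2) := by
          gcongr
          linarith [sq_nonneg x]
      _ = (|p| + |s|) * (1 + x ^ 2) := by ring
  calc |saturationSlope x * (p * x + s)|
      ≤ 1 / (1 + x ^ 2) * ((|p| + |s|) * (1 + x ^ 2)) := by rw [abs_mul]; gcongr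
    _ = |p| + |s| := by field_simp

theorem le_mul_saturationSlope_mul (p s x : ℝ) :
    s ^ 2 / 2 - (3 * s ^ 2 + p ^ 2) * (x * saturation x) ≤
      s * (saturationSlope x * (p * x + s)) := by
  have gap_eq : s * (saturationSlope x * (p * x + s)) -
      (s ^ 2 / 2 - (3 * s ^ 2 + p ^ 2) * (x * saturation x)) =
      ((s + p * x) ^ 2 + (s * x - p * x ^ 2) ^ 2 + (s * x) ^ 2 + 5 * (s * x ^ 2) ^ 2 +
        (p * x) ^ 2 + (p * x ^ 2) ^ 2) / (2 * (1 + x ^ 2) ^ 2) := by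
    simp only [saturation, saturationSlope]
    field_simp
    ring
  rw [← sub_nonneg, gap_eq]
  positivity

end Saturation

section NormalForm

/-- The error system in the coordinates `e = x - xm`, `ψ = b (θh - θ)`, with gain `g = b γ` and
forcing `s = b r`: `e' = a e + x ψ`, `ψ' = -g x e`, `x' = (a + ψ) x + s` on `[t₀, ∞)`. The
reference state does not occur in it. -/
structure IsNormalizedErrorSolution (a g s t₀ : ℝ) (e ψ x : ℝ → ℝ) : Prop where
  error : ∀ t ∈ Set.Ici t₀, HasDerivWithinAt e (a * e t + x t * ψ t) (Set.Ici t₀) t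
  parameter : ∀ t ∈ Set.Ici t₀, HasDerivWithinAt ψ (-g * x t * e t) (Set.Ici t₀) t
  state : ∀ t ∈ Set.Ici t₀, HasDerivWithinAt x ((a + ψ t) * x t + s) (Set.Ici t₀) t

/-- The energy of the error, a Lyapunov function whose dissipation controls only `e`. -/
def errorEnergy (g e ψ : ℝ) : ℝ := g * e ^ 2 + ψ ^ 2

/-- The correction of the energy: its growth along solutions controls `ψ`. The term `e ψ` does so
away from `x = 0`, the term with weight `μ` near `x = 0`. -/
noncomputable def energyCorrection (μ s e ψ x : ℝ) : ℝ := ψ * (e + μ * s * ψ) * saturation x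

/-- The derivative of `energyCorrection μ s` along the normalized error system. -/
noncomputable def energyCorrectionDeriv (a g μ s e ψ x : ℝ) : ℝ :=
  let d := saturationSlope x * ((a + ψ) * x + s)
  (x * saturation x + μ * (s * d)) * ψ ^ 2 +
    (a * saturation x - 2 * g * μ * s * (x * saturation x) + d) * (e * ψ) -
      g * (x * saturation x) * e ^ 2

variable {a g s t₀ : ℝ} {e ψ x : ℝ → ℝ}

theorem errorEnergy_nonneg (hg : 0 ≤ g) (e ψ : ℝ) : 0 ≤ errorEnergy g e ψ := by
  unfold errorEnergy
  positivity

theorem IsNormalizedErrorSolution.hasDerivWithinAt_errorEnergy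
    (h : IsNormalizedErrorSolution a g s t₀ e ψ x) {t : ℝ} (ht : t ∈ Ici t₀) :
    HasDerivWithinAt (fun t => errorEnergy g (e t) (ψ t)) (2 * a * g * e t ^ 2) (Ici t₀) t := by
  refine ((((h.error t ht).pow 2).const_mul g).add ((h.parameter t ht).pow 2)).congr_deriv ?_
  push_cast
  ring

theorem IsNormalizedErrorSolution.errorEnergy_le (h : IsNormalizedErrorSolution a g s t₀ e ψ x)
    (ha : a ≤ 0) (hg : 0 ≤ g) {t : ℝ} (ht : t₀ ≤ t) :
    errorEnergy g (e t) (ψ t) ≤ errorEnergy g (e t₀) (ψ t₀) :=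
  antitoneOn_Ici_of_hasDerivWithinAt_nonpos (fun _ => h.hasDerivWithinAt_errorEnergy)
    (fun s _ => mul_nonpos_of_nonpos_of_nonneg
      (mul_nonpos_of_nonpos_of_nonneg (by linarith) hg) (sq_nonneg (e s))) self_mem_Ici ht ht

theorem IsNormalizedErrorSolution.hasDerivWithinAt_energyCorrection
    (h : IsNormalizedErrorSolution a g s t₀ e ψ x) (μ : ℝ) {t : ℝ} (ht : t ∈ Ici t₀) :
    HasDerivWithinAt (fun t => energyCorrection μ s (e t) (ψ t) (x t))
      (energyCorrectionDeriv a g μ s (e t) (ψ t) (x t)) (Ici t₀) t := by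
  refine (((h.parameter t ht).mul ((h.error t ht).add ((h.parameter t ht).const_mul (μ * s)))).mul
    ((hasDerivAt_saturation (x t)).comp_hasDerivWithinAt t (h.state t ht))).congr_deriv ?_
  simp only [energyCorrectionDeriv, Function.comp_apply, Pi.mul_apply, Pi.add_apply]
  ring

theorem abs_energyCorrection_le (hg : 0 < g) (hμ : 0 ≤ μ) (e ψ x : ℝ) :
    |energyCorrection μ s e ψ x| ≤ (1 / g + 1 + μ * |s|) * errorEnergy g e ψ := by
  have factor_le : |ψ * (e + μ * s * ψ)| ≤ |ψ| * |e| + μ * |s| * ψ ^ 2 := by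
    rw [show ψ * (e + μ * s * ψ) = ψ * e + μ * s * ψ ^ 2 by ring]
    refine (abs_add_le _ _).trans_eq ?_
    rw [abs_mul, abs_mul (μ * s), abs_mul μ, abs_of_nonneg hμ, abs_of_nonneg (sq_nonneg ψ)]
  have cross_le : |ψ| * |e| ≤ (ψ ^ 2 + e ^ 2) / 2 := by
    linarith [sq_nonneg (|ψ| - |e|), sub_sq |ψ| |e|, sq_abs ψ, sq_abs e]
  have energy_nonneg := errorEnergy_nonneg hg.le e ψ
  have sq_error_le : e ^ 2 ≤ 1 / g * errorEnergy g e ψ := by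
    rw [one_div_mul_eq_div, le_div_iff₀ hg, errorEnergy]
    linarith [sq_nonneg ψ]
  have sq_parameter_le : ψ ^ 2 ≤ errorEnergy g e ψ :=
    le_add_of_nonneg_left (mul_nonneg hg.le (sq_nonneg e))
  have : 0 ≤ μ * |s| := by positivity
  calc |energyCorrection μ s e ψ x|
      ≤ (|ψ| * |e| + μ * |s| * ψ ^ 2) * (1 / 2) := by
        rw [energyCorrection, abs_mul]
        gcongr
        exact abs_saturation_le_half x
    _ ≤ (1 / g + 1 + μ * |s|) * errorEnergy g e ψ := by
        linarith [mul_le_mul_of_nonneg_left sq_parameter_le this, sq_nonneg e,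
          mul_nonneg this energy_nonneg, sq_nonneg ψ]

theorem half_mul_sq_sub_le_of_abs_le {m k X N : ℝ} (hm : 0 < m) (hmk : m ≤ k) (hX : |X| ≤ N)
    (e ψ : ℝ) : m / 2 * ψ ^ 2 - N ^ 2 / (2 * m) * e ^ 2 ≤ k * ψ ^ 2 + X * (e * ψ) := by
  have hX_sq : X ^ 2 * e ^ 2 ≤ N ^ 2 * e ^ 2 :=
    mul_le_mul_of_nonneg_right (sq_le_sq' (neg_le_of_abs_le hX) (le_of_abs_le hX)) (sq_nonneg e)
  have complete_square : m / 2 * ψ ^ 2 + X * (e * ψ) + N ^ 2 / (2 * m) * e ^ 2 =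
      ((m * ψ + X * e) ^ 2 + (N ^ 2 * e ^ 2 - X ^ 2 * e ^ 2)) / (2 * m) := by
    field_simp
    ring
  have : 0 ≤ m / 2 * ψ ^ 2 + X * (e * ψ) + N ^ 2 / (2 * m) * e ^ 2 := by
    rw [complete_square]
    exact div_nonneg (add_nonneg (sq_nonneg _) (sub_nonneg.2 hX_sq)) (by positivity)
  linarith [mul_le_mul_of_nonneg_right hmk (sq_nonneg ψ)]

theorem half_mul_sq_le_mul_saturation_add {μ p : ℝ} (hμ : 0 ≤ μ)
    (hμp : μ * (3 * s ^ 2 + p ^ 2) ≤ 1) (x : ℝ) :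
    μ * s ^ 2 / 2 ≤ x * saturation x + μ * (s * (saturationSlope x * (p * x + s))) := by
  linarith [mul_le_mul_of_nonneg_left (le_mul_saturationSlope_mul p s x) hμ,
    mul_le_mul_of_nonneg_right hμp (mul_saturation_nonneg x)]

theorem le_energyCorrectionDeriv {μ P : ℝ} (hg : 0 ≤ g) (hμ : 0 < μ) (hs : s ≠ 0) {e ψ x : ℝ}
    (hP : |a + ψ| ≤ P) (hμP : μ * (3 * s ^ 2 + P ^ 2) ≤ 1) :
    μ * s ^ 2 / 4 * ψ ^ 2 - (g + (|a| + 2 * g * μ * |s| + P + |s|) ^ 2 / (μ * s ^ 2)) * e ^ 2 ≤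
      energyCorrectionDeriv a g μ s e ψ x := by
  let q := x * saturation x
  let d := saturationSlope x * ((a + ψ) * x + s)
  have hq₀ : 0 ≤ q := mul_saturation_nonneg x
  have hq₁ : q ≤ 1 := mul_saturation_le_one x
  have hP_sq : (a + ψ) ^ 2 ≤ P ^ 2 := sq_le_sq' (neg_le_of_abs_le hP) (le_of_abs_le hP)
  have excitation : μ * s ^ 2 / 2 ≤ q + μ * (s * d) :=
    half_mul_sq_le_mul_saturation_add hμ.le (le_trans (by gcongr) hμP) x
  have cross_le : |a * saturation x - 2 * g * μ * s * q + d| ≤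
      |a| + 2 * g * μ * |s| + P + |s| := by
    have hσ : |a * saturation x| ≤ |a| := by
      rw [abs_mul]
      exact mul_le_of_le_one_right (abs_nonneg a) ((abs_saturation_le_half x).trans (by norm_num))
    have hq : |2 * g * μ * s * q| ≤ 2 * g * μ * |s| := by
      rw [abs_mul, abs_mul, abs_of_nonneg hq₀, abs_of_nonneg (by positivity : 0 ≤ 2 * g * μ)]
      exact mul_le_of_le_one_right (by positivity) hq₁
    have hd : |d| ≤ P + |s| := (abs_saturationSlope_mul_le _ _ _).trans (by gcongr)
    linarith [abs_add_le (a * saturation x - 2 * g * μ * s * q) d,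
      abs_sub (a * saturation x) (2 * g * μ * s * q)]
  have quadratic_le := half_mul_sq_sub_le_of_abs_le
    (by positivity : 0 < μ * s ^ 2 / 2) excitation cross_le e ψ
  rw [show μ * s ^ 2 / 2 / 2 = μ * s ^ 2 / 4 by ring,
    show 2 * (μ * s ^ 2 / 2) = μ * s ^ 2 by ring] at quadratic_le
  have hgq : g * q * e ^ 2 ≤ g * e ^ 2 := by
    gcongr
    exact mul_le_of_le_one_right hg hq₁
  unfold energyCorrectionDeriv
  linarith

theorem exists_rate_errorEnergy_le (ha : a < 0) (hg : 0 < g) (hs : s ≠ 0) (V : ℝ) :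
    ∃ c > 0, ∀ (t₀ : ℝ) (e ψ x : ℝ → ℝ), IsNormalizedErrorSolution a g s t₀ e ψ x →
      errorEnergy g (e t₀) (ψ t₀) ≤ V → ∀ t ≥ t₀,
        errorEnergy g (e t) (ψ t) ≤
          3 * errorEnergy g (e t₀) (ψ t₀) * Real.exp (-c * (t - t₀)) := by
  let P := |a| + √V
  let μ := 1 / (3 * s ^ 2 + P ^ 2)
  let A := 1 / g + 1 + μ * |s|
  let β := μ * s ^ 2 / 4
  let κ := g + (|a| + 2 * g * μ * |s| + P + |s|) ^ 2 / (μ * s ^ 2) + β * g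
  let l := min (1 / 2 / A) (2 * -a * g / κ)
  have hμ : 0 < μ := by positivity
  have hA : 0 < A := by positivity
  have hκ : 0 < κ := by positivity
  have hl : 0 < l := lt_min (by positivity) (div_pos (mul_pos (by linarith) hg) hκ)
  refine ⟨l * β / 2, by positivity, fun t₀ e ψ x h hV t ht => ?_⟩
  have parameter_le : ∀ τ ∈ Ici t₀, |a + ψ τ| ≤ P := fun τ hτ => by
    refine (abs_add_le _ _).trans (add_le_add_right (Real.abs_le_sqrt ?_) _)
    calc ψ τ ^ 2 ≤ errorEnergy g (e τ) (ψ τ) :=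
          le_add_of_nonneg_left (mul_nonneg hg.le (sq_nonneg (e τ)))
      _ ≤ V := (h.errorEnergy_le ha.le hg.le hτ).trans hV
  refine le_mul_exp_of_corrected_dissipation (A := A) (α := 2 * -a * g) (β := β) (κ := κ)
    (D := fun τ => e τ ^ 2)
    (fun _ => h.hasDerivWithinAt_errorEnergy) (fun _ => h.hasDerivWithinAt_energyCorrection μ)
    (fun _ _ => errorEnergy_nonneg hg.le _ _) (fun _ _ => sq_nonneg _)
    (fun _ _ => abs_energyCorrection_le hg hμ.le _ _ _) (fun τ _ => by linarith)
    (fun τ hτ => ?_) (by positivity) hl.le ((le_div_iff₀ hA).1 (min_le_left _ _))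
    ((le_div_iff₀ hκ).1 (min_le_right _ _)) ht
  have := le_energyCorrectionDeriv (x := x τ) (e := e τ) hg.le hμ hs (parameter_le τ hτ)
    (one_div_mul_cancel (by positivity)).le
  simp only [errorEnergy, κ, β]
  linarith

end NormalForm

section OpenLoopReferenceModel

/-- The vector field of the adaptive system in the coordinates `(x, xm, θh)`. -/
def ormField (a b θ γ r : ℝ) (p : ℝ × ℝ × ℝ) : ℝ × ℝ × ℝ :=
  (a * p.1 - b * θ * p.1 + b * (p.2.2 * p.1 + r), a * p.2.1 + b * r, -γ * p.1 * (p.1 - p.2.1))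

/-- The energy of the error plus the square of the velocity of the reference state: a Lyapunov
function of the adaptive system with bounded sublevel sets. -/
def ormEnergy (a b θ γ r : ℝ) (p : ℝ × ℝ × ℝ) : ℝ :=
  errorEnergy (b * γ) (p.1 - p.2.1) (b * (p.2.2 - θ)) + (a * p.2.1 + b * r) ^ 2

variable {a b θ γ r t₀ : ℝ} {x xm θh : ℝ → ℝ}

theorem contDiff_ormField : ContDiff ℝ 1 (ormField a b θ γ r) := by
  unfold ormField
  fun_prop

theorem isORMSolution_iff_isIntegralCurveOn :
    IsORMSolution a b θ γ r t₀ x xm θh ↔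
      IsIntegralCurveOn (fun t => (x t, xm t, θh t)) (fun _ => ormField a b θ γ r) (Ici t₀) := by
  refine ⟨fun h t ht => (h.plant t ht).prodMk ((h.reference t ht).prodMk (h.update t ht)),
    fun h => ?_⟩
  have components (t : ℝ) (ht : t ∈ Ici t₀) :=
    (hasDerivWithinAt_prodMk_iff.1 (h t ht)).imp_right hasDerivWithinAt_prodMk_iff.1
  exact ⟨fun t ht => (components t ht).1, fun t ht => (components t ht).2.1,
    fun t ht => (components t ht).2.2⟩

theorem IsORMSolution.eqOn_Ici {x' xm' θh' : ℝ → ℝ} (h : IsORMSolution a b θ γ r t₀ x xm θh)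
    (h' : IsORMSolution a b θ γ r t₀ x' xm' θh') (hx : x t₀ = x' t₀) (hxm : xm t₀ = xm' t₀)
    (hθ : θh t₀ = θh' t₀) :
    EqOn (fun t => (x t, xm t, θh t)) (fun t => (x' t, xm' t, θh' t)) (Ici t₀) :=
  eqOn_Ici_of_isIntegralCurveOn contDiff_ormField.locallyLipschitz
    (isORMSolution_iff_isIntegralCurveOn.1 h) (isORMSolution_iff_isIntegralCurveOn.1 h')
    (by simp only [hx, hxm, hθ])

theorem differentiable_ormEnergy : Differentiable ℝ (ormEnergy a b θ γ r) := by
  unfold ormEnergy errorEnergy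
  fun_prop

theorem fderiv_ormEnergy_ormField (p : ℝ × ℝ × ℝ) :
    fderiv ℝ (ormEnergy a b θ γ r) p (ormField a b θ γ r p) =
      2 * a * (b * γ * (p.1 - p.2.1) ^ 2 + (a * p.2.1 + b * r) ^ 2) := by
  have hx : HasFDerivAt (fun q : ℝ × ℝ × ℝ => q.1) (.fst ℝ ℝ (ℝ × ℝ)) p := hasFDerivAt_fst
  have hsnd : HasFDerivAt (fun q : ℝ × ℝ × ℝ => q.2) (.snd ℝ ℝ (ℝ × ℝ)) p := hasFDerivAt_snd
  have hW : HasFDerivAt (ormEnergy a b θ γ r) _ p :=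
    ((((hx.sub hsnd.fst).pow 2).const_mul (b * γ)).add
      (((hsnd.snd.sub_const θ).const_mul b).pow 2)).add
        (((hsnd.fst.const_mul a).add_const (b * r)).pow 2)
  rw [hW.fderiv]
  simp [ormField]
  ring

theorem isBounded_ormEnergy_le (ha : a ≠ 0) (hbγ : 0 < b * γ) (V : ℝ) :
    Bornology.IsBounded {p | ormEnergy a b θ γ r p ≤ V} := by
  let coords (q : ℝ × ℝ × ℝ) : ℝ × ℝ × ℝ :=
    (q.1 + (q.2.2 - b * r) / a, (q.2.2 - b * r) / a, q.2.1 / b + θ)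
  let R := max √(V / (b * γ)) √V
  have hcoords : Continuous coords := by fun_prop
  refine ((isCompact_closedBall 0 R).image hcoords).isBounded.subset fun p hp => ?_
  refine ⟨(p.1 - p.2.1, b * (p.2.2 - θ), a * p.2.1 + b * r), ?_, ?_⟩
  · have hp' : b * γ * (p.1 - p.2.1) ^ 2 + (b * (p.2.2 - θ)) ^ 2 + (a * p.2.1 + b * r) ^ 2 ≤ V := hp
    have he := mul_nonneg hbγ.le (sq_nonneg (p.1 - p.2.1))
    have hψ := sq_nonneg (b * (p.2.2 - θ))
    have hw := sq_nonneg (a * p.2.1 + b * r)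
    simp only [mem_closedBall_zero_iff, Prod.norm_def, Real.norm_eq_abs, sup_le_iff]
    refine ⟨le_max_of_le_left (Real.abs_le_sqrt ?_), le_max_of_le_right (Real.abs_le_sqrt ?_),
      le_max_of_le_right (Real.abs_le_sqrt ?_)⟩
    · rw [le_div_iff₀ hbγ]
      linarith
    · linarith
    · linarith
  · have hb : b ≠ 0 := left_ne_zero_of_mul hbγ.ne'
    ext <;> simp [coords] <;> field_simp <;> ring

theorem exists_isORMSolution (ha : a < 0) (hbγ : 0 < b * γ) (t₀ x₀ xm₀ θ₀ : ℝ) :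
    ∃ x xm θh : ℝ → ℝ, IsORMSolution a b θ γ r t₀ x xm θh ∧
      x t₀ = x₀ ∧ xm t₀ = xm₀ ∧ θh t₀ = θ₀ := by
  have energy_nonincreasing (p : ℝ × ℝ × ℝ) :
      fderiv ℝ (ormEnergy a b θ γ r) p (ormField a b θ γ r p) ≤ 0 := by
    rw [fderiv_ormEnergy_ormField]
    exact mul_nonpos_of_nonpos_of_nonneg (by linarith) (by positivity)
  obtain ⟨α, hα₀, hα⟩ := exists_isIntegralCurveOn_Ici_of_fderiv_nonpos contDiff_ormField
    differentiable_ormEnergy energy_nonincreasing (x₀, xm₀, θ₀)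
    (isBounded_ormEnergy_le ha.ne hbγ _) t₀
  exact ⟨fun t => (α t).1, fun t => (α t).2.1, fun t => (α t).2.2,
    isORMSolution_iff_isIntegralCurveOn.2 hα, by simp [hα₀]⟩

theorem IsORMSolution.isNormalizedErrorSolution (h : IsORMSolution a b θ γ r t₀ x xm θh) :
    IsNormalizedErrorSolution a (b * γ) (b * r) t₀ (fun t => x t - xm t)
      (fun t => b * (θh t - θ)) x where
  error t ht := ((h.plant t ht).sub (h.reference t ht)).congr_deriv (by ring)
  parameter t ht := (((h.update t ht).sub_const θ).const_mul b).congr_deriv (by ring)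
  state t ht := (h.plant t ht).congr_deriv (by ring)

end OpenLoopReferenceModel

section UASL

theorem IsUASL.of_norm_le_mul_exp {E : Type*} [NormedAddCommGroup E] {S : ℝ → Set (ℝ → E)}
    {K : ℝ} (hK : 0 < K)
    (hS : ∀ ρ > 0, ∃ c > 0, ∀ t₀ : ℝ, 0 ≤ t₀ → ∀ z ∈ S t₀, ‖z t₀‖ ≤ ρ →
      ∀ t ≥ t₀, ‖z t‖ ≤ K * ‖z t₀‖ * Real.exp (-c * (t - t₀))) : IsUASL S := by
  have norm_le (ρ : ℝ) (hρ : 0 < ρ) (t₀ : ℝ) (ht₀ : 0 ≤ t₀) (z : ℝ → E) (hz : z ∈ S t₀)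
      (hz₀ : ‖z t₀‖ ≤ ρ) (t : ℝ) (ht : t ≥ t₀) : ‖z t‖ ≤ K * ‖z t₀‖ := by
    obtain ⟨c, hc, hdecay⟩ := hS ρ hρ
    refine (hdecay t₀ ht₀ z hz hz₀ t ht).trans (mul_le_of_le_one_right (by positivity) ?_)
    rw [Real.exp_le_one_iff]
    exact mul_nonpos_of_nonpos_of_nonneg (by linarith) (by linarith)
  constructor
  case stable =>
    refine fun ε hε => ⟨ε / K, by positivity, fun t₀ ht₀ z hz hz₀ t ht => ?_⟩
    exact (norm_le _ (by positivity) t₀ ht₀ z hz hz₀ t ht).trans ((le_div_iff₀' hK).1 hz₀)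
  case bounded =>
    refine fun ρ hρ => ⟨K * ρ, fun t₀ ht₀ z hz hz₀ t ht => ?_⟩
    exact (norm_le ρ hρ t₀ ht₀ z hz hz₀ t ht).trans (by gcongr)
  case attracting =>
    intro ρ hρ η hη
    obtain ⟨c, hc, hdecay⟩ := hS ρ hρ
    have tendsto_bound : Tendsto (fun T : ℝ => K * ρ * Real.exp (-(c * T))) atTop (𝓝 0) := by
      simpa using (Real.tendsto_exp_neg_atTop_nhds_zero.comp
        (tendsto_id.const_mul_atTop hc)).const_mul (K * ρ)
    obtain ⟨T, hT₀, hT⟩ :=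
      ((eventually_ge_atTop 0).and (tendsto_bound.eventually_le_const hη)).exists
    refine ⟨T, hT₀, fun t₀ ht₀ z hz hz₀ t ht => ?_⟩
    calc ‖z t‖ ≤ K * ‖z t₀‖ * Real.exp (-c * (t - t₀)) := hdecay t₀ ht₀ z hz hz₀ t (by linarith)
      _ ≤ K * ρ * Real.exp (-(c * T)) := by
        rw [neg_mul]
        gcongr
        linarith
      _ ≤ η := hT

theorem min_mul_norm_sq_le (c d y z : ℝ) :
    min c d * ‖(!₂[y, z] : Plane)‖ ^ 2 ≤ c * y ^ 2 + d * z ^ 2 := by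
  simp only [EuclideanSpace.norm_sq_eq, Fin.sum_univ_two, Real.norm_eq_abs, sq_abs, mul_add]
  exact add_le_add (mul_le_mul_of_nonneg_right (min_le_left c d) (sq_nonneg y))
    (mul_le_mul_of_nonneg_right (min_le_right c d) (sq_nonneg z))

theorem le_max_mul_norm_sq (c d y z : ℝ) :
    c * y ^ 2 + d * z ^ 2 ≤ max c d * ‖(!₂[y, z] : Plane)‖ ^ 2 := by
  simp only [EuclideanSpace.norm_sq_eq, Fin.sum_univ_two, Real.norm_eq_abs, sq_abs, mul_add]
  exact add_le_add (mul_le_mul_of_nonneg_right (le_max_left c d) (sq_nonneg y))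
    (mul_le_mul_of_nonneg_right (le_max_right c d) (sq_nonneg z))

theorem isUASL_ormErrorTrajectories {a b θ γ r : ℝ} (ha : a < 0) (hbγ : 0 < b * γ) (hr : r ≠ 0) :
    IsUASL (ormErrorTrajectories a b θ γ r) := by
  have hb : b ≠ 0 := left_ne_zero_of_mul hbγ.ne'
  let m := min (b * γ) (b ^ 2)
  let M := max (b * γ) (b ^ 2)
  have hm : 0 < m := lt_min hbγ (by positivity)
  have : 0 < M := hbγ.trans_le (le_max_left _ _)
  have energy_eq (e φ : ℝ) : errorEnergy (b * γ) e (b * φ) = b * γ * e ^ 2 + b ^ 2 * φ ^ 2 := by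
    rw [errorEnergy, mul_pow]
  refine .of_norm_le_mul_exp (K := √(3 * M / m)) (by positivity) fun ρ _ => ?_
  obtain ⟨c, hc, hdecay⟩ :=
    exists_rate_errorEnergy_le ha hbγ (mul_ne_zero hb hr) (M * ρ ^ 2)
  refine ⟨c / 2, by positivity, fun t₀ _ z ⟨x, xm, θh, h, hz⟩ hz₀ t ht => ?_⟩
  have initial_energy_le : errorEnergy (b * γ) (x t₀ - xm t₀) (b * (θh t₀ - θ)) ≤
      M * ‖z t₀‖ ^ 2 := by
    rw [energy_eq, hz t₀ le_rfl]
    exact le_max_mul_norm_sq _ _ _ _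
  have sq_le : m * ‖z t‖ ^ 2 ≤ 3 * M * ‖z t₀‖ ^ 2 * Real.exp (-c * (t - t₀)) :=
    calc m * ‖z t‖ ^ 2 ≤ errorEnergy (b * γ) (x t - xm t) (b * (θh t - θ)) := by
          rw [energy_eq, hz t ht]
          exact min_mul_norm_sq_le _ _ _ _
      _ ≤ 3 * errorEnergy (b * γ) (x t₀ - xm t₀) (b * (θh t₀ - θ)) * Real.exp (-c * (t - t₀)) :=
          hdecay t₀ _ _ x h.isNormalizedErrorSolution
            (initial_energy_le.trans (by gcongr)) t ht
      _ ≤ 3 * M * ‖z t₀‖ ^ 2 * Real.exp (-c * (t - t₀)) := by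
          rw [mul_assoc 3 M]
          gcongr
  refine le_of_sq_le_sq ?_ (by positivity)
  rw [mul_pow, mul_pow, Real.sq_sqrt (by positivity), ← Real.exp_nat_mul]
  rw [← le_div_iff₀' hm] at sq_le
  convert sq_le using 1
  push_cast
  ring_nf

end UASL

theorem mainTheorem7_general (a b θ γ r : ℝ) (ha : a < 0) (hbγ : 0 < b * γ) (hr : r ≠ 0) :
    (∀ t₀ x₀ xm₀ θ₀ : ℝ,
      (∃ x xm θh : ℝ → ℝ, IsORMSolution a b θ γ r t₀ x xm θh ∧
        x t₀ = x₀ ∧ xm t₀ = xm₀ ∧ θh t₀ = θ₀) ∧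
      (∀ x xm θh x' xm' θh' : ℝ → ℝ,
        IsORMSolution a b θ γ r t₀ x xm θh → IsORMSolution a b θ γ r t₀ x' xm' θh' →
        x t₀ = x₀ → xm t₀ = xm₀ → θh t₀ = θ₀ → x' t₀ = x₀ → xm' t₀ = xm₀ → θh' t₀ = θ₀ →
        ∀ t ≥ t₀, x t = x' t ∧ xm t = xm' t ∧ θh t = θh' t)) ∧
    IsUASL (ormErrorTrajectories a b θ γ r) := by
  refine ⟨fun t₀ x₀ xm₀ θ₀ => ⟨exists_isORMSolution ha hbγ t₀ x₀ xm₀ θ₀, ?_⟩,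
    isUASL_ormErrorTrajectories ha hbγ hr⟩
  intro x xm θh x' xm' θh' h h' hx hxm hθ hx' hxm' hθ' t ht
  simpa only [Prod.mk.injEq] using
    h.eqOn_Ici h' (hx.trans hx'.symm) (hxm.trans hxm'.symm) (hθ.trans hθ'.symm) ht

theorem mainTheorem7 (a b θ γ r : ℝ) (ha : a < 0) (hb : 0 < b) (hγ : 0 < γ) (hr : r ≠ 0) :
    -- the system has exactly one solution on `[t₀, ∞)` for all initial data
    (∀ t₀ : ℝ, 0 ≤ t₀ → ∀ x₀ xm₀ θ₀ : ℝ,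
      (∃ x xm θh : ℝ → ℝ, IsORMSolution a b θ γ r t₀ x xm θh ∧
        x t₀ = x₀ ∧ xm t₀ = xm₀ ∧ θh t₀ = θ₀) ∧
      (∀ x xm θh x' xm' θh' : ℝ → ℝ,
        IsORMSolution a b θ γ r t₀ x xm θh → IsORMSolution a b θ γ r t₀ x' xm' θh' →
        x t₀ = x₀ → xm t₀ = xm₀ → θh t₀ = θ₀ → x' t₀ = x₀ → xm' t₀ = xm₀ → θh' t₀ = θ₀ →
        ∀ t ≥ t₀, x t = x' t ∧ xm t = xm' t ∧ θh t = θh' t)) ∧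
    -- the equilibrium `z = 0` of the error dynamics is UASL
    IsUASL (ormErrorTrajectories a b θ γ r) := by
  have h := mainTheorem7_general a b θ γ r ha (mul_pos hb hγ) hr
  exact ⟨fun t₀ _ => h.1 t₀, h.2⟩
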